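/- **Lemma (Information-Theoretical Subspace Hiding Function).** Let $k, r, s, \lambda, q$ be non-negative integers with $r+\lambda+s\le k$. Let $S\subseteq\mathbb{Z}_2^k$ be a subspace of dimension $r+\lambda$ and let $S_0\subseteq S$ be a subspace of dimension $r$. For $i\in\{1,\dots,\lambda\}$ let $S_i$ be a subspace of dimension $r+\lambda-1$ with $S_0\subseteq S_i\subseteq S$, such that $S_i\ne S_j$ for all distinct $i,j\in\{1,\dots,\lambda-1\}$. Let $T_0$ be uniformly random among the subspaces of $\mathbb{Z}_2^k$ of dimension $r+s$ that contain $S_0$; for $i\in\{1,\dots,\lambda\}$ let $T_i=T_0+S_i$ be the linear span of $T_0$ and $S_i$, and let $T=T_0+S$. For a subspace $S'\subseteq\mathbb{Z}_2^k$ let $\mathcal{O}_{S'}$ be the oracle that outputs $1$ on inputs in $S'$ and $0$ on all other inputs. Then for every (computationally unbounded) quantum algorithm $\mathcal{A}$ with a one-bit output that makes at most $q$ quantum queries in total to its oracles (a query is the unitary $|i,x,b,w\rangle\mapsto|i,x,b\oplus\mathcal{O}^{(i)}(x),w\rangle$, where $i$ names one of the $\lambda+2$ oracles and $w$ is the content of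 a finite workspace), $$ \Bigl|\Pr\bigl[\mathcal{A}^{\mathcal{O}_{S_0},\dots,\mathcal{O}_{S_\lambda},\mathcal{O}_S}=1\bigr]-\Pr_{T_0}\bigl[\mathcal{A}^{\mathcal{O}_{T_0},\dots,\mathcal{O}_{T_\lambda},\mathcal{O}_T}=1\bigr]\Bigr|\;\le\;\frac{q\cdot c_s}{\sqrt{2^{\,k-r-\lambda-s}}}, \qquad c_s=\begin{cases}s&\text{if } s\ne 1,\\ \sqrt2&\text{if } s=1.\end{cases} $$ -/

import Mathlib

open Module

/-- The space `ℤ₂^k`. -/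
abbrev BitVector (k : ℕ) : Type := Fin k → ZMod 2

/-- Subspaces of `ℤ₂^k`. -/
abbrev BitSubspace (k : ℕ) : Type := Submodule (ZMod 2) (BitVector k)

/-- The Hilbert space with orthonormal basis `|i, x, b, w⟩`: an oracle label `i : L`, a query input
`x : X`, an answer bit `b`, and the content `w : W` of a finite workspace. -/
abbrev QueryState (L X W : Type*) : Type _ := EuclideanSpace ℂ (L × X × ZMod 2 × W)

/-- The permutation `(i, x, b, w) ↦ (i, x, b ⊕ O i x, w)` of the basis. -/
def queryPerm {L X : Type*} (W : Type*) (O : L → X → ZMod 2) :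
    Equiv.Perm (L × X × ZMod 2 × W) where
  toFun z := (z.1, z.2.1, z.2.2.1 + O z.1 z.2.1, z.2.2.2)
  invFun z := (z.1, z.2.1, z.2.2.1 - O z.1 z.2.1, z.2.2.2)
  left_inv z := by simp
  right_inv z := by simp

/-- One quantum query to a family of oracles `O i : X → ℤ₂`, `i : L`: the unitary
`|i, x, b, w⟩ ↦ |i, x, b ⊕ O i x, w⟩`. -/
noncomputable def queryUnitary {L X : Type*} (W : Type*) [Fintype L] [Fintype X] [Fintype W]
    (O : L → X → ZMod 2) : QueryState L X W ≃ₗᵢ[ℂ] QueryState L X W :=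
  LinearIsometryEquiv.piLpCongrLeft 2 ℂ ℂ (queryPerm W O)

/-- A (computationally unbounded, non-uniform) quantum algorithm with access to a family of oracles
labelled by `L`, with inputs in `X` and one-bit answers, and with workspace `W`. It starts in the
state `init`; for `j = 0, …, queries - 1` it makes a query and then applies the unitary `gate j`;
finally it measures in the computational basis and outputs `1` iff the outcome is in `accept`.
Only the `gate j` with `j < queries` matter. -/
structure QueryAlgorithm (L X W : Type*) [Fintype L] [Fintype X] [Fintype W] where
  queries : ℕ
  init : QueryState L X W
  norm_init : ‖init‖ = 1
  gate : ℕ → (QueryState L X W ≃ₗᵢ[ℂ] QueryState L X W)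
  accept : Finset (L × X × ZMod 2 × W)

namespace QueryAlgorithm

variable {L X W : Type*} [Fintype L] [Fintype X] [Fintype W]

/-- The state after `j` queries and the gates that follow them. -/
noncomputable def state (A : QueryAlgorithm L X W) (O : L → X → ZMod 2) : ℕ → QueryState L X W
  | 0 => A.init
  | j + 1 => A.gate j (queryUnitary W O (A.state O j))

/-- The probability that the algorithm outputs `1` with the oracles `O`. -/
noncomputable def acceptProb (A : QueryAlgorithm L X W) (O : L → X → ZMod 2) : ℝ :=
  ∑ z ∈ A.accept, ‖A.state O A.queries z‖ ^ 2

end QueryAlgorithm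

open Classical in
/-- The membership oracles of a family of subspaces: label `i` answers `1` on `x` if `x ∈ U i`, and
`0` otherwise. -/
noncomputable def membershipOracles {L : Type*} {k : ℕ} (U : L → BitSubspace k) :
    L → BitVector k → ZMod 2 :=
  fun i x => if x ∈ U i then 1 else 0

/-- The tuple `(U 0, …, U l, V)`, with `V` at the label `none`. -/
def subspaceTuple {k l : ℕ} (U : Fin (l + 1) → BitSubspace k) (V : BitSubspace k) :
    Option (Fin (l + 1)) → BitSubspace k
  | some i => U i
  | none => V

/-- The finite set of the `d`-dimensional subspaces `T` with `S₀ ⊆ T ⊆ ℤ₂^k`. -/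
noncomputable def superspaces {k : ℕ} (S₀ : BitSubspace k) (d : ℕ) : Finset (BitSubspace k) :=
  (Set.toFinite {T : BitSubspace k | S₀ ≤ T ∧ finrank (ZMod 2) T = d}).toFinset

/-- The average of `f` over a uniformly random element of `Ω`. -/
noncomputable def uniformAverage {ι : Type*} (Ω : Finset ι) (f : ι → ℝ) : ℝ :=
  (∑ t ∈ Ω, f t) / (Ω.card : ℝ)

/-!
Replacing the oracles of `Sᵢ` by those of `T₀ + Sᵢ` changes the answer to a query `(i, x)` only if
`x ∈ (T₀ + Sᵢ) \ Sᵢ`, and for a fixed `(i, x)` this event is rare. Put `n = k - r`. By symmetry all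
vectors outside `S₀` lie in equally many of the spaces `T₀` (`exists_linearEquiv_map_eq`), so each
lies in a random `T₀` with probability `(2 ^ s - 1) / (2 ^ n - 1)`. If `x ∉ Sᵢ` and
`x ∈ T₀ + Sᵢ`, then `T₀` meets the coset `x + Sᵢ`, which consists of at most `2 ^ l` cosets of `S₀`;
hence the event has probability at most `p = 2 ^ l (2 ^ s - 1) / (2 ^ n - 1)`
(`card_superspaces_mem_sup_le`).

The hybrid argument (`QueryAlgorithm.abs_acceptProb_sub_le`) replaces the oracles query by query,
so that each step compares the two answers to one query in a state `φ` which does not depend on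
`T₀`. Unit vectors `u`, `v` are told apart by a measurement with advantage at most
`‖u - v‖ ‖u + v‖ / 2`. Here `‖u - v‖²` is at most four times the weight of `φ` on the queries with
a changed answer, and `‖u + v‖² = 4 - ‖u - v‖²`. Averaging over `T₀` with the Cauchy–Schwarz
inequality gives an advantage of at most `2 √(e (1 - e))` per query, for some `e ≤ p`
(`exists_sum_norm_mul_norm_le`).

For `s ≠ 1` the bound `2 √p ≤ s / √(2 ^ (n - l - s))` suffices. For `s = 1` it just fails, since
`p = 2 ^ l / (2 ^ n - 1)` exceeds `2 ^ l / 2 ^ n`; the factor `1 - e`, which the cruder estimate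
`‖u - v‖` of the advantage would lose, restores the constant `√2`
(`two_mul_sqrt_mul_one_sub_le`).
-/

/-! ### Counting superspaces that meet a coset -/

theorem mem_superspaces {k : ℕ} {S₀ T : BitSubspace k} {d : ℕ} :
    T ∈ superspaces S₀ d ↔ S₀ ≤ T ∧ finrank (ZMod 2) T = d := by
  simp [superspaces]

theorem card_filter_mem_bitSubspace {k : ℕ} (U : BitSubspace k) [DecidablePred (· ∈ U)] :
    (Finset.univ.filter (· ∈ U)).card = 2 ^ finrank (ZMod 2) U := by
  have h := Module.natCard_eq_pow_finrank (K := ZMod 2) (V := U)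
  rw [Nat.card_zmod] at h
  rw [← h, Nat.card_eq_fintype_card, Fintype.card_subtype]

theorem superspaces_nonempty {k d : ℕ} (S₀ : BitSubspace k) (h₀ : finrank (ZMod 2) S₀ ≤ d)
    (hd : d ≤ k) : (superspaces S₀ d).Nonempty := by
  induction d, h₀ using Nat.le_induction with
  | base => exact ⟨S₀, mem_superspaces.2 ⟨le_rfl, rfl⟩⟩
  | succ d _ ih =>
    obtain ⟨T, hT⟩ := ih (by omega)
    obtain ⟨hle, hfin⟩ := mem_superspaces.1 hT
    have hne : T ≠ ⊤ := by
      rintro rfl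
      rw [finrank_top, Module.finrank_fin_fun] at hfin
      omega
    obtain ⟨v, hv⟩ : ∃ v, v ∉ T := by
      by_contra! h
      exact hne (eq_top_iff.2 fun v _ => h v)
    refine ⟨T ⊔ Submodule.span (ZMod 2) {v}, mem_superspaces.2 ⟨hle.trans le_sup_left, ?_⟩⟩
    rw [Submodule.finrank_sup_span_singleton hv, hfin]

/-- The automorphisms of `ℤ₂^k` that preserve `S₀` act transitively on the vectors outside `S₀`:
a transvection along `y + z` exchanges `y` and `z`. -/
theorem exists_linearEquiv_map_eq {k : ℕ} (S₀ : BitSubspace k) {y z : BitVector k}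
    (hy : y ∉ S₀) (hz : z ∉ S₀) :
    ∃ f : BitVector k ≃ₗ[ZMod 2] BitVector k, S₀.map (f : BitVector k →ₗ[ZMod 2] BitVector k) = S₀ ∧
      f y = z := by
  have hchar : ∀ x : BitVector k, x + x = 0 := fun x => by
    ext i; exact CharTwo.add_self_eq_zero _
  have hy' : y ∉ S₀ ⊔ Submodule.span (ZMod 2) {y + z} := by
    intro h
    obtain ⟨u, hu, w, hw, huw⟩ := Submodule.mem_sup.1 h
    obtain ⟨c, rfl⟩ := Submodule.mem_span_singleton.1 hw
    have hc : ∀ c : ZMod 2, c = 0 ∨ c = 1 := by decide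
    obtain rfl | rfl := hc c
    · rw [zero_smul, add_zero] at huw
      exact hy (huw ▸ hu)
    · have huz : u = z := by
        rw [one_smul] at huw
        calc u = u + (y + z) + (y + z) := by rw [add_assoc, hchar, add_zero]
          _ = z := by rw [huw, ← add_assoc, hchar, zero_add]
      exact hz (huz ▸ hu)
  obtain ⟨φ, hφ, hle⟩ := Submodule.exists_le_ker_of_notMem hy'
  have hφ₁ : φ y = 1 := by
    generalize φ y = c at hφ
    revert c; decide
  have hφ₀ : ∀ u ∈ S₀, φ u = 0 := fun u hu => hle (Submodule.mem_sup_left hu)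
  have hφyz : φ (y + z) = 0 := hle (Submodule.mem_sup_right (Submodule.mem_span_singleton_self _))
  let g : BitVector k →ₗ[ZMod 2] BitVector k := LinearMap.id + φ.smulRight (y + z)
  have hg : ∀ x, g x = x + φ x • (y + z) := fun x => rfl
  have hinv : ∀ x, g (g x) = x := by
    intro x
    rw [hg (g x), hg x, map_add, map_smul, hφyz, smul_zero, add_zero, add_assoc, hchar, add_zero]
  refine ⟨LinearEquiv.ofInvolutive g hinv, ?_, ?_⟩
  · have hfix : ∀ u ∈ S₀, g u = u := fun u hu => by rw [hg, hφ₀ u hu, zero_smul, add_zero]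
    ext u
    constructor
    · rintro ⟨v, hv, rfl⟩
      exact (hfix v hv).symm ▸ hv
    · exact fun hu => ⟨u, hu, hfix u hu⟩
  · change g y = z
    rw [hg, hφ₁, one_smul, ← add_assoc, hchar, zero_add]

open Classical in
theorem card_superspaces_mem_eq {k d : ℕ} (S₀ : BitSubspace k) {y z : BitVector k}
    (hy : y ∉ S₀) (hz : z ∉ S₀) :
    ((superspaces S₀ d).filter (y ∈ ·)).card = ((superspaces S₀ d).filter (z ∈ ·)).card := by
  obtain ⟨f, hf, hfy⟩ := exists_linearEquiv_map_eq S₀ hy hz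
  refine Finset.card_equiv (Submodule.orderIsoMapComap f).toEquiv fun T => ?_
  have hmap : (Submodule.orderIsoMapComap f).toEquiv T
      = T.map (f : BitVector k →ₗ[ZMod 2] BitVector k) := rfl
  have hle : S₀ ≤ T.map (f : BitVector k →ₗ[ZMod 2] BitVector k) ↔ S₀ ≤ T := by
    conv_lhs => rw [← hf]
    exact Submodule.map_le_map_iff_of_injective f.injective _ _
  have hmem : z ∈ T.map (f : BitVector k →ₗ[ZMod 2] BitVector k) ↔ y ∈ T := by
    rw [← hfy]
    exact f.injective.mem_set_image (s := (T : Set (BitVector k)))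
  rw [Finset.mem_filter, Finset.mem_filter, mem_superspaces, mem_superspaces, hmap, hle, hmem,
    LinearEquiv.finrank_map_eq]

open Classical in
/-- Each vector outside `S₀` lies in the same number of superspaces, so double counting the pairs
`y ∈ T`, `y ∉ S₀` determines that number. -/
theorem card_superspaces_mem_mul {k d : ℕ} (S₀ : BitSubspace k) {y : BitVector k} (hy : y ∉ S₀) :
    (((superspaces S₀ d).filter (y ∈ ·)).card : ℝ) * (2 ^ k - 2 ^ finrank (ZMod 2) S₀)
      = (superspaces S₀ d).card * (2 ^ d - 2 ^ finrank (ZMod 2) S₀) := by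
  have key := Finset.sum_card_bipartiteAbove_eq_sum_card_bipartiteBelow
    (fun (z : BitVector k) (T : BitSubspace k) => z ∈ T)
    (s := Finset.univ.filter (· ∉ S₀)) (t := superspaces S₀ d)
  have hconst : ∀ z ∈ Finset.univ.filter (· ∉ S₀),
      (Finset.bipartiteAbove (fun (z : BitVector k) (T : BitSubspace k) => z ∈ T)
        (superspaces S₀ d) z).card = ((superspaces S₀ d).filter (y ∈ ·)).card :=
    fun z hz => card_superspaces_mem_eq S₀ (Finset.mem_filter.1 hz).2 hy
  rw [Finset.sum_const_nat hconst, Finset.sum_const_nat (m := 2 ^ d - 2 ^ finrank (ZMod 2) S₀)] at key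
  · have hd : superspaces S₀ d ≠ ∅ → 2 ^ finrank (ZMod 2) S₀ ≤ 2 ^ d := by
      intro h
      obtain ⟨T, hT⟩ := Finset.nonempty_iff_ne_empty.2 h
      obtain ⟨h₁, h₂⟩ := mem_superspaces.1 hT
      exact Nat.pow_le_pow_right two_pos (h₂ ▸ Submodule.finrank_mono h₁)
    have hcompl : ((Finset.univ.filter (· ∉ S₀)).card : ℝ) = 2 ^ k - 2 ^ finrank (ZMod 2) S₀ := by
      have := Finset.card_filter_add_card_filter_not (s := (Finset.univ : Finset (BitVector k)))
        (· ∈ S₀)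
      rw [card_filter_mem_bitSubspace, Finset.card_univ, Fintype.card_fun, ZMod.card,
        Fintype.card_fin] at this
      rw [eq_sub_iff_add_eq, add_comm]
      exact_mod_cast this
    by_cases h : superspaces S₀ d = ∅
    · simp [h]
    · have := congrArg (Nat.cast (R := ℝ)) key
      rw [Nat.cast_mul, Nat.cast_mul, hcompl, Nat.cast_sub (hd h)] at this
      push_cast at this
      rw [mul_comm, this]
  · intro T hT
    obtain ⟨h₁, h₂⟩ := mem_superspaces.1 hT
    have hsplit := Finset.card_filter_add_card_filter_not
      (s := Finset.univ.filter (· ∈ T)) (· ∈ S₀)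
    rw [card_filter_mem_bitSubspace, h₂, Finset.filter_filter, Finset.filter_filter] at hsplit
    have e₁ : (Finset.univ.filter fun a => a ∈ T ∧ a ∈ S₀) = Finset.univ.filter (· ∈ S₀) :=
      Finset.filter_congr fun a _ => ⟨fun h => h.2, fun h => ⟨h₁ h, h⟩⟩
    have e₂ : Finset.bipartiteBelow (fun (z : BitVector k) (T : BitSubspace k) => z ∈ T)
        (Finset.univ.filter (· ∉ S₀)) T = Finset.univ.filter fun a => a ∈ T ∧ a ∉ S₀ := by
      ext a
      simp [Finset.bipartiteBelow, and_comm]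
    rw [e₁, card_filter_mem_bitSubspace] at hsplit
    rw [e₂]
    omega

open Classical in
/-- A union bound over the coset `x + U`: if `x ∈ T ⊔ U`, then `T`, which contains `S₀`, meets
`x + U` in at least `|S₀|` points. -/
theorem card_superspaces_mem_sup_mul_le {k d c : ℕ} (S₀ U : BitSubspace k) (hU : S₀ ≤ U)
    {x : BitVector k} (hc : ∀ y ∉ S₀, ((superspaces S₀ d).filter (y ∈ ·)).card ≤ c) (hx : x ∉ U) :
    ((superspaces S₀ d).filter (fun T => x ∈ T ⊔ U)).card * 2 ^ finrank (ZMod 2) S₀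
      ≤ 2 ^ finrank (ZMod 2) U * c := by
  have key := Finset.sum_card_bipartiteAbove_eq_sum_card_bipartiteBelow
    (fun (u : BitVector k) (T : BitSubspace k) => x - u ∈ T)
    (s := Finset.univ.filter (· ∈ U)) (t := superspaces S₀ d)
  calc
    _ = ∑ _T ∈ (superspaces S₀ d).filter (fun T => x ∈ T ⊔ U), 2 ^ finrank (ZMod 2) S₀ := by simp
    _ ≤ ∑ T ∈ (superspaces S₀ d).filter (fun T => x ∈ T ⊔ U),
        (Finset.bipartiteBelow (fun (u : BitVector k) (T : BitSubspace k) => x - u ∈ T)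
          (Finset.univ.filter (· ∈ U)) T).card := by
      refine Finset.sum_le_sum fun T hT => ?_
      obtain ⟨hTΩ, hxT⟩ := Finset.mem_filter.1 hT
      obtain ⟨t, ht, u, hu, rfl⟩ := Submodule.mem_sup.1 hxT
      rw [← card_filter_mem_bitSubspace S₀]
      refine Finset.card_le_card_of_injOn (fun a => u + a) ?_ (add_right_injective u).injOn
      intro a ha
      have ha : a ∈ S₀ := by simpa using ha
      have : t + u - (u + a) = t - a := by abel
      simp only [Finset.bipartiteBelow, Finset.coe_filter, Finset.mem_filter, Finset.mem_univ,
        true_and, Set.mem_ofPred_eq, this]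
      exact ⟨U.add_mem hu (hU ha), T.sub_mem ht ((mem_superspaces.1 hTΩ).1 ha)⟩
    _ ≤ ∑ T ∈ superspaces S₀ d,
        (Finset.bipartiteBelow (fun (u : BitVector k) (T : BitSubspace k) => x - u ∈ T)
          (Finset.univ.filter (· ∈ U)) T).card :=
      Finset.sum_le_sum_of_subset (Finset.filter_subset _ _)
    _ = _ := key.symm
    _ ≤ ∑ _u ∈ Finset.univ.filter (· ∈ U), c := by
      refine Finset.sum_le_sum fun u hu => hc _ fun h => hx ?_
      have := U.add_mem (hU h) (Finset.mem_filter.1 hu).2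
      rwa [sub_add_cancel] at this
    _ = _ := by rw [Finset.sum_const, card_filter_mem_bitSubspace, smul_eq_mul]

open Classical in
/-- If `S₀` has codimension at most `l` in `U` and `x ∉ U`, then `x ∈ T ⊔ U` holds with probability
at most `2 ^ l (2 ^ s - 1) / (2 ^ (k - r) - 1)` for a uniformly random `T`. -/
theorem card_superspaces_mem_sup_le {k r s l : ℕ} (S₀ U : BitSubspace k)
    (h₀ : finrank (ZMod 2) S₀ = r) (hU : S₀ ≤ U) (hUl : finrank (ZMod 2) U ≤ r + l)
    {x : BitVector k} (hx : x ∉ U) :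
    (((superspaces S₀ (r + s)).filter (fun T => x ∈ T ⊔ U)).card : ℝ)
      ≤ (superspaces S₀ (r + s)).card * (2 ^ l * (2 ^ s - 1) / (2 ^ (k - r) - 1)) := by
  have hx₀ : x ∉ S₀ := fun h => hx (hU h)
  have hrk : r < k := by
    have hlt : S₀ < ⊤ := lt_top_iff_ne_top.2 fun h => hx₀ (h ▸ Submodule.mem_top)
    have := Submodule.finrank_lt_finrank_of_lt hlt
    rwa [finrank_top, Module.finrank_fin_fun, h₀] at this
  have hunion := card_superspaces_mem_sup_mul_le (d := r + s) S₀ U hU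
    (fun y hy => (card_superspaces_mem_eq S₀ hy hx₀).le) hx
  have hcount := card_superspaces_mem_mul (d := r + s) S₀ hx₀
  set c := ((superspaces S₀ (r + s)).filter (x ∈ ·)).card
  set b := ((superspaces S₀ (r + s)).filter (fun T => x ∈ T ⊔ U)).card
  rw [h₀] at hunion hcount
  have hr : (0 : ℝ) < 2 ^ r := by positivity
  have hb : (b : ℝ) ≤ 2 ^ l * c := by
    have h : (b : ℝ) * 2 ^ r ≤ 2 ^ finrank (ZMod 2) U * c := by exact_mod_cast hunion
    have h' : (2 : ℝ) ^ finrank (ZMod 2) U ≤ 2 ^ r * 2 ^ l := by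
      rw [← pow_add]; exact pow_le_pow_right₀ one_le_two hUl
    refine le_of_mul_le_mul_right (h.trans ?_) hr
    calc _ ≤ (2 : ℝ) ^ r * 2 ^ l * c := by gcongr
      _ = _ := by ring
  have hn : (1 : ℝ) < 2 ^ (k - r) := one_lt_pow₀ one_lt_two (by omega)
  have hc : (c : ℝ) * (2 ^ (k - r) - 1) = (superspaces S₀ (r + s)).card * (2 ^ s - 1) := by
    have hk : (2 : ℝ) ^ k = 2 ^ r * 2 ^ (k - r) := by rw [← pow_add]; congr 1; omega
    rw [hk, pow_add] at hcount
    refine mul_left_cancel₀ hr.ne' ?_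
    linear_combination hcount
  rw [← mul_div_assoc, le_div_iff₀ (sub_pos.2 hn)]
  calc (b : ℝ) * (2 ^ (k - r) - 1) ≤ 2 ^ l * c * (2 ^ (k - r) - 1) := by
        gcongr
    _ = _ := by rw [mul_assoc, hc]; ring

/-! ### Acceptance probabilities and hybrids -/

/-- For unit vectors the right-hand side is `√(1 - (Re ⟪u, v⟫)²)`. -/
theorem abs_sum_norm_sq_sub_le {ι : Type*} [Fintype ι] (P : Finset ι) (u v : EuclideanSpace ℂ ι)
    (huv : ‖u‖ = ‖v‖) :
    |∑ z ∈ P, ‖u z‖ ^ 2 - ∑ z ∈ P, ‖v z‖ ^ 2| ≤ ‖u - v‖ * ‖u + v‖ / 2 := by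
  classical
  have hpt : ∀ z, |‖u z‖ ^ 2 - ‖v z‖ ^ 2| ≤ ‖(u - v) z‖ * ‖(u + v) z‖ := by
    intro z
    have h₁ := abs_norm_sub_norm_le (u z ^ 2) (v z ^ 2)
    have h₂ : u z ^ 2 - v z ^ 2 = (u - v) z * (u + v) z := by
      simp only [PiLp.sub_apply, PiLp.add_apply]; ring
    have h₃ : |‖u z‖ ^ 2 - ‖v z‖ ^ 2| ≤ ‖u z ^ 2 - v z ^ 2‖ := by
      rwa [norm_pow, norm_pow] at h₁
    rwa [h₂, norm_mul] at h₃
  have hcs : ∑ z, |‖u z‖ ^ 2 - ‖v z‖ ^ 2| ≤ ‖u - v‖ * ‖u + v‖ := by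
    refine (Finset.sum_le_sum fun z _ => hpt z).trans ?_
    refine abs_le_of_sq_le_sq' ?_ (by positivity) |>.2
    rw [mul_pow, EuclideanSpace.norm_sq_eq, EuclideanSpace.norm_sq_eq]
    exact Finset.sum_mul_sq_le_sq_mul_sq _ _ _
  have hsum : ∑ z ∈ P, (‖u z‖ ^ 2 - ‖v z‖ ^ 2) + ∑ z ∈ Pᶜ, (‖u z‖ ^ 2 - ‖v z‖ ^ 2) = 0 := by
    rw [Finset.sum_add_sum_compl, Finset.sum_sub_distrib, ← EuclideanSpace.norm_sq_eq,
      ← EuclideanSpace.norm_sq_eq, huv, sub_self]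
  have habs := Finset.sum_add_sum_compl P fun z => |‖u z‖ ^ 2 - ‖v z‖ ^ 2|
  have hP := Finset.abs_sum_le_sum_abs (fun z => ‖u z‖ ^ 2 - ‖v z‖ ^ 2) P
  have hPc := Finset.abs_sum_le_sum_abs (fun z => ‖u z‖ ^ 2 - ‖v z‖ ^ 2) Pᶜ
  rw [← neg_eq_of_add_eq_zero_right hsum, abs_neg] at hPc
  rw [← Finset.sum_sub_distrib]
  linarith

section QueryModel

variable {L X W : Type*} [Fintype L] [Fintype X] [Fintype W]

theorem queryUnitary_apply (O : L → X → ZMod 2) (φ : QueryState L X W) (z : L × X × ZMod 2 × W) :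
    queryUnitary W O φ z = φ ((queryPerm W O).symm z) := rfl

theorem QueryAlgorithm.norm_state (A : QueryAlgorithm L X W) (O : L → X → ZMod 2) (j : ℕ) :
    ‖A.state O j‖ = 1 := by
  induction j with
  | zero => exact A.norm_init
  | succ j ih => rw [QueryAlgorithm.state, LinearIsometryEquiv.norm_map,
      LinearIsometryEquiv.norm_map, ih]

/-- The hybrid argument: replace the queries to `O` by queries to `O'`, the last one first. Only
the states of the run with `O` enter the bound. The isometry `V` stands for the part of the run
that has been dealt with already. -/
theorem QueryAlgorithm.abs_sum_norm_sq_state_sub_le (A : QueryAlgorithm L X W)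
    (O O' : L → X → ZMod 2) (m : ℕ) (V : QueryState L X W ≃ₗᵢ[ℂ] QueryState L X W) :
    |∑ z ∈ A.accept, ‖V (A.state O m) z‖ ^ 2 - ∑ z ∈ A.accept, ‖V (A.state O' m) z‖ ^ 2|
      ≤ ∑ j ∈ Finset.range m,
        ‖queryUnitary W O (A.state O j) - queryUnitary W O' (A.state O j)‖ *
          ‖queryUnitary W O (A.state O j) + queryUnitary W O' (A.state O j)‖ / 2 := by
  induction m generalizing V with
  | zero => simp [QueryAlgorithm.state]
  | succ m ih =>
    rw [Finset.sum_range_succ]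
    have h₁ := ih (((queryUnitary W O').trans (A.gate m)).trans V)
    have h₂ := abs_sum_norm_sq_sub_le A.accept
      (V (A.gate m (queryUnitary W O (A.state O m))))
      (V (A.gate m (queryUnitary W O' (A.state O m)))) (by simp only [LinearIsometryEquiv.norm_map])
    rw [← map_sub, ← map_sub, ← map_add, ← map_add] at h₂
    simp only [LinearIsometryEquiv.norm_map] at h₂
    rw [add_comm (∑ j ∈ _, _)]
    exact (abs_sub_le _ _ _).trans (add_le_add h₂ h₁)

theorem QueryAlgorithm.abs_acceptProb_sub_le (A : QueryAlgorithm L X W) (O O' : L → X → ZMod 2) :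
    |A.acceptProb O - A.acceptProb O'| ≤ ∑ j ∈ Finset.range A.queries,
        ‖queryUnitary W O (A.state O j) - queryUnitary W O' (A.state O j)‖ *
          ‖queryUnitary W O (A.state O j) + queryUnitary W O' (A.state O j)‖ / 2 :=
  A.abs_sum_norm_sq_state_sub_le O O' A.queries (LinearIsometryEquiv.refl ℂ _)

open Classical in
/-- A query distinguishes two oracle families only through the part of the state whose query
`(i, x)` is answered differently. -/
theorem norm_sq_queryUnitary_sub_le (O O' : L → X → ZMod 2) (φ : QueryState L X W) :
    ‖queryUnitary W O φ - queryUnitary W O' φ‖ ^ 2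
      ≤ 4 * ∑ z, if O z.1 z.2.1 ≠ O' z.1 z.2.1 then ‖φ z‖ ^ 2 else 0 := by
  set g : L × X × ZMod 2 × W → ℝ := fun z => if O z.1 z.2.1 ≠ O' z.1 z.2.1 then ‖φ z‖ ^ 2 else 0
  have hpt : ∀ z, ‖(queryUnitary W O φ - queryUnitary W O' φ) z‖ ^ 2
      ≤ 2 * (g ((queryPerm W O).symm z) + g ((queryPerm W O').symm z)) := by
    rintro ⟨i, x, b, w⟩
    rw [PiLp.sub_apply, queryUnitary_apply, queryUnitary_apply]
    by_cases h : O i x = O' i x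
    · simp [g, queryPerm, h]
    · have h₁ : g ((queryPerm W O).symm (i, x, b, w))
          = ‖φ ((queryPerm W O).symm (i, x, b, w))‖ ^ 2 := if_pos h
      have h₂ : g ((queryPerm W O').symm (i, x, b, w))
          = ‖φ ((queryPerm W O').symm (i, x, b, w))‖ ^ 2 := if_pos h
      rw [h₁, h₂]
      have h₃ := norm_sub_le (φ ((queryPerm W O).symm (i, x, b, w)))
        (φ ((queryPerm W O').symm (i, x, b, w)))
      exact (pow_le_pow_left₀ (norm_nonneg _) h₃ 2).trans (add_sq_le)
  rw [EuclideanSpace.norm_sq_eq]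
  refine (Finset.sum_le_sum fun z _ => hpt z).trans (le_of_eq ?_)
  rw [← Finset.mul_sum, Finset.sum_add_distrib, Equiv.sum_comp, Equiv.sum_comp]
  ring

open Classical in
/-- If the answer to each query `(i, x)` changes for at most a fraction `p` of the oracle families
`O' t`, then on average one query to `O' t` in place of `O` is noticed with advantage at most
`2 √(e (1 - e))` for some `e ≤ p`. -/
theorem exists_sum_norm_mul_norm_le {ι : Type*} (Ω : Finset ι) (hΩ : Ω.Nonempty)
    (O : L → X → ZMod 2) (O' : ι → L → X → ZMod 2) (φ : QueryState L X W) (hφ : ‖φ‖ = 1) {p : ℝ}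
    (hp : ∀ i x, ((Ω.filter fun t => O i x ≠ O' t i x).card : ℝ) ≤ Ω.card * p) :
    ∃ e : ℝ, 0 ≤ e ∧ e ≤ p ∧
      ∑ t ∈ Ω, ‖queryUnitary W O φ - queryUnitary W (O' t) φ‖ *
        ‖queryUnitary W O φ + queryUnitary W (O' t) φ‖ / 2 ≤ Ω.card * (2 * √(e * (1 - e))) := by
  have hN : (0 : ℝ) < Ω.card := by exact_mod_cast hΩ.card_pos
  set D := ∑ t ∈ Ω, ‖queryUnitary W O φ - queryUnitary W (O' t) φ‖ ^ 2 with hD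
  have hD₀ : 0 ≤ D := Finset.sum_nonneg fun _ _ => by positivity
  have hDp : D ≤ 4 * (Ω.card * p) := by
    calc
      D ≤ ∑ t ∈ Ω, 4 * ∑ z : L × X × ZMod 2 × W,
          if O z.1 z.2.1 ≠ O' t z.1 z.2.1 then ‖φ z‖ ^ 2 else 0 :=
        Finset.sum_le_sum fun t _ => norm_sq_queryUnitary_sub_le O (O' t) φ
      _ = 4 * ∑ z : L × X × ZMod 2 × W,
          ((Ω.filter fun t => O z.1 z.2.1 ≠ O' t z.1 z.2.1).card : ℝ) * ‖φ z‖ ^ 2 := by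
        rw [← Finset.mul_sum, Finset.sum_comm]
        congr 1
        refine Finset.sum_congr rfl fun z _ => ?_
        rw [← Finset.sum_filter, Finset.sum_const, nsmul_eq_mul]
      _ ≤ 4 * ∑ z : L × X × ZMod 2 × W, (Ω.card * p) * ‖φ z‖ ^ 2 := by
        gcongr with z
        exact hp _ _
      _ = 4 * (Ω.card * p) := by
        rw [← Finset.mul_sum, ← EuclideanSpace.norm_sq_eq, hφ]; ring
  have hsum : ∑ t ∈ Ω, ‖queryUnitary W O φ + queryUnitary W (O' t) φ‖ ^ 2 = 4 * Ω.card - D := by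
    rw [eq_sub_iff_add_eq, hD, ← Finset.sum_add_distrib]
    have hpar : ∀ t ∈ Ω, ‖queryUnitary W O φ + queryUnitary W (O' t) φ‖ ^ 2
        + ‖queryUnitary W O φ - queryUnitary W (O' t) φ‖ ^ 2 = 4 := by
      intro t _
      rw [parallelogram_law_with_norm ℂ, LinearIsometryEquiv.norm_map,
        LinearIsometryEquiv.norm_map, hφ]
      norm_num
    rw [Finset.sum_congr rfl hpar, Finset.sum_const, nsmul_eq_mul, mul_comm]
  clear_value D
  refine ⟨D / (4 * Ω.card), by positivity, ?_, ?_⟩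
  · rw [div_le_iff₀ (by positivity)]; linarith
  · have hcs := Finset.sum_mul_sq_le_sq_mul_sq Ω
      (fun t => ‖queryUnitary W O φ - queryUnitary W (O' t) φ‖)
      (fun t => ‖queryUnitary W O φ + queryUnitary W (O' t) φ‖)
    rw [hsum, ← hD] at hcs
    rw [← Finset.sum_div]
    have hsq : D * (4 * Ω.card - D)
        = (4 * Ω.card) ^ 2 * (D / (4 * Ω.card) * (1 - D / (4 * Ω.card))) := by
      field_simp
    rw [hsq] at hcs
    have := Real.le_sqrt_of_sq_le hcs
    rw [Real.sqrt_mul (by positivity), Real.sqrt_sq (by positivity)] at this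
    linarith

open Classical in
/-- The average form of the hybrid bound, where `B` bounds the advantage of a single query. -/
theorem QueryAlgorithm.abs_acceptProb_sub_uniformAverage_le (A : QueryAlgorithm L X W)
    {ι : Type*} (Ω : Finset ι) (hΩ : Ω.Nonempty) (O : L → X → ZMod 2) (O' : ι → L → X → ZMod 2)
    {p B : ℝ} (hp : ∀ i x, ((Ω.filter fun t => O i x ≠ O' t i x).card : ℝ) ≤ Ω.card * p)
    (hB : ∀ e : ℝ, 0 ≤ e → e ≤ p → 2 * √(e * (1 - e)) ≤ B) :
    |A.acceptProb O - uniformAverage Ω (fun t => A.acceptProb (O' t))| ≤ A.queries * B := by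
  have hN : (0 : ℝ) < Ω.card := by exact_mod_cast hΩ.card_pos
  have havg : A.acceptProb O - uniformAverage Ω (fun t => A.acceptProb (O' t))
      = (∑ t ∈ Ω, (A.acceptProb O - A.acceptProb (O' t))) / Ω.card := by
    rw [uniformAverage, Finset.sum_sub_distrib, Finset.sum_const, nsmul_eq_mul]
    field_simp
  rw [havg, abs_div, abs_of_pos hN, div_le_iff₀ hN]
  refine (Finset.abs_sum_le_sum_abs _ _).trans
    ((Finset.sum_le_sum fun t _ => A.abs_acceptProb_sub_le O (O' t)).trans ?_)
  rw [Finset.sum_comm]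
  have hstep : ∀ j ∈ Finset.range A.queries,
      ∑ t ∈ Ω, ‖queryUnitary W O (A.state O j) - queryUnitary W (O' t) (A.state O j)‖ *
        ‖queryUnitary W O (A.state O j) + queryUnitary W (O' t) (A.state O j)‖ / 2
        ≤ Ω.card * B := by
    intro j _
    obtain ⟨e, he₀, hep, he⟩ :=
      exists_sum_norm_mul_norm_le Ω hΩ O O' (A.state O j) (A.norm_state O j) hp
    exact he.trans (by gcongr; exact hB e he₀ hep)
  refine (Finset.sum_le_sum hstep).trans (le_of_eq ?_)
  rw [Finset.sum_const, Finset.card_range, nsmul_eq_mul]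
  ring

end QueryModel

/-! ### The advantage of one query -/

/-- The factor `1 - e` matters for `s = 1` only: there `p` may exceed `2 ^ l / 2 ^ n`, but then
`1 - p ≤ 1 - 2⁻ⁿ` makes up for the denominator `2 ^ n - 1` of `p`. -/
theorem two_mul_sqrt_mul_one_sub_le {n l s : ℕ} (h : l + s ≤ n) {e : ℝ} (he₀ : 0 ≤ e)
    (he : e ≤ 2 ^ l * (2 ^ s - 1) / (2 ^ n - 1)) :
    2 * √(e * (1 - e)) ≤ (if s = 1 then √2 else (s : ℝ)) / √((2 : ℝ) ^ (n - l - s)) := by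
  obtain ⟨m, rfl⟩ := Nat.exists_eq_add_of_le h
  have hm : l + s + m - l - s = m := by omega
  have hpow : (2 : ℝ) ^ (l + s + m) = 2 ^ l * 2 ^ s * 2 ^ m := by rw [pow_add, pow_add]
  have hl : (1 : ℝ) ≤ 2 ^ l := one_le_pow₀ one_le_two
  have hs : (1 : ℝ) ≤ 2 ^ s := one_le_pow₀ one_le_two
  have hM : (1 : ℝ) ≤ 2 ^ m := one_le_pow₀ one_le_two
  rw [hm]
  obtain rfl | hs0 := Nat.eq_zero_or_pos s
  · obtain rfl : e = 0 := le_antisymm (by simpa using he) he₀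
    simp
  have hs2 : (2 : ℝ) ≤ 2 ^ s := le_self_pow₀ one_le_two hs0.ne'
  have hn : (2 : ℝ) ≤ 2 ^ (l + s + m) := le_self_pow₀ one_le_two (by omega)
  have hn1 : (0 : ℝ) < 2 ^ (l + s + m) - 1 := by linarith
  rw [le_div_iff₀ (by positivity)]
  have hen : e * (2 ^ (l + s + m) - 1) ≤ 2 ^ l * (2 ^ s - 1) := (le_div_iff₀ hn1).1 he
  suffices hsq : 4 * (e * (1 - e)) * 2 ^ m ≤ (if s = 1 then √2 else (s : ℝ)) ^ 2 by
    have hc : 0 ≤ (if s = 1 then √2 else (s : ℝ)) := by split_ifs <;> positivity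
    rw [← Real.sqrt_sq hc]
    refine le_trans (le_of_eq ?_) (Real.sqrt_le_sqrt hsq)
    have h4 : √(4 : ℝ) = 2 := by
      rw [show (4 : ℝ) = 2 ^ 2 by norm_num, Real.sqrt_sq two_pos.le]
    rw [Real.sqrt_mul' (4 * (e * (1 - e))) (by positivity),
      Real.sqrt_mul (by norm_num : (0 : ℝ) ≤ 4) (e * (1 - e)), h4]
  -- the crude bound by `(2 ^ s - 1) / (2 ^ n - 1) ≤ 2 ^ s / 2 ^ n`
  have hcrude : e * 2 ^ m ≤ 1 := by
    have h₁ : 2 ^ l * (2 ^ s - 1) * 2 ^ m ≤ (2 : ℝ) ^ (l + s + m) - 1 := by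
      rw [hpow]; nlinarith [mul_le_mul hl hM zero_le_one (by positivity)]
    have h₂ := (mul_le_mul_of_nonneg_right hen (by positivity : (0 : ℝ) ≤ 2 ^ m)).trans h₁
    refine le_of_mul_le_mul_right ?_ hn1
    linarith
  split_ifs with hs1
  · subst hs1
    rw [Real.sq_sqrt two_pos.le]
    rw [pow_one] at hpow hen
    have hgoal : e * (1 - e) * 2 ^ (l + 1 + m) ≤ 2 ^ l := by
      by_cases hc : e * 2 ^ (l + 1 + m) ≤ 1
      · have : e * (1 - e) * 2 ^ (l + 1 + m) ≤ e * 2 ^ (l + 1 + m) := by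
          have := mul_nonneg (mul_nonneg he₀ he₀) (by positivity : (0 : ℝ) ≤ 2 ^ (l + 1 + m))
          linarith
        linarith
      · -- here `(1 - e) * 2 ^ n ≤ 2 ^ n - 1`
        have : e * ((1 - e) * 2 ^ (l + 1 + m)) ≤ e * (2 ^ (l + 1 + m) - 1) :=
          mul_le_mul_of_nonneg_left (by linarith) he₀
        linarith
    rw [hpow] at hgoal
    have hl0 : (0 : ℝ) < 2 ^ l := by positivity
    refine le_of_mul_le_mul_left ?_ hl0
    linarith
  · have hs' : (2 : ℝ) ≤ s := by exact_mod_cast (by omega : 2 ≤ s)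
    have : e * (1 - e) * 2 ^ m ≤ e * 2 ^ m := by
      have := mul_nonneg (mul_nonneg he₀ he₀) (by positivity : (0 : ℝ) ≤ 2 ^ m)
      linarith
    nlinarith

/-! ### The hidden subspace -/

open Classical in
/-- A membership oracle changes its answer, when `U` is replaced by `T ⊔ U`, only at the points of
`(T ⊔ U) \ U`. -/
theorem card_membershipOracles_ne_le {k r s l : ℕ} {Λ : Type*} (S₀ : BitSubspace k)
    (h₀ : finrank (ZMod 2) S₀ = r) (U : Λ → BitSubspace k)
    (hU : ∀ i, S₀ ≤ U i) (hUl : ∀ i, finrank (ZMod 2) (U i) ≤ r + l) (i : Λ) (x : BitVector k) :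
    (((superspaces S₀ (r + s)).filter fun T =>
        membershipOracles U i x ≠ membershipOracles (fun j => T ⊔ U j) i x).card : ℝ)
      ≤ (superspaces S₀ (r + s)).card * (2 ^ l * (2 ^ s - 1) / (2 ^ (k - r) - 1)) := by
  by_cases hx : x ∈ U i
  · have hempty : ((superspaces S₀ (r + s)).filter fun T =>
        membershipOracles U i x ≠ membershipOracles (fun j => T ⊔ U j) i x) = ∅ := by
      refine Finset.filter_eq_empty_iff.2 fun T _ => not_not.2 ?_
      have : x ∈ T ⊔ U i := Submodule.mem_sup_right hx
      simp [membershipOracles, hx, this]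
    have hs : (1 : ℝ) ≤ 2 ^ s := one_le_pow₀ one_le_two
    have hn : (1 : ℝ) ≤ 2 ^ (k - r) := one_le_pow₀ one_le_two
    rw [hempty, Finset.card_empty, Nat.cast_zero]
    exact mul_nonneg (Nat.cast_nonneg _)
      (div_nonneg (mul_nonneg (by positivity) (sub_nonneg.2 hs)) (sub_nonneg.2 hn))
  · refine le_trans ?_ (card_superspaces_mem_sup_le S₀ (U i) h₀ (hU i) (hUl i) hx)
    refine Nat.cast_le.2 (Finset.card_le_card fun T hT => ?_)
    obtain ⟨hT, hne⟩ := Finset.mem_filter.1 hT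
    refine Finset.mem_filter.2 ⟨hT, ?_⟩
    by_contra h
    exact hne (by simp [membershipOracles, hx, h])

theorem mainTheorem11 (k r s l q : ℕ) (hk : r + l + s ≤ k)
    (Si : Fin (l + 1) → BitSubspace k) (S : BitSubspace k)
    (hS : finrank (ZMod 2) S = r + l)
    (hS₀ : finrank (ZMod 2) (Si 0) = r) (hS₀S : Si 0 ≤ S)
    (hSi : ∀ i : Fin (l + 1), i ≠ 0 →
      Si 0 ≤ Si i ∧ Si i ≤ S ∧ finrank (ZMod 2) (Si i) = r + l - 1)
    (hne : ∀ i j : Fin (l + 1), i ≠ 0 → j ≠ 0 → (i : ℕ) ≤ l - 1 → (j : ℕ) ≤ l - 1 →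
      i ≠ j → Si i ≠ Si j)
    {W : Type*} [Fintype W]
    (A : QueryAlgorithm (Option (Fin (l + 1))) (BitVector k) W) (hA : A.queries ≤ q) :
    |A.acceptProb (membershipOracles (subspaceTuple Si S)) -
        uniformAverage (superspaces (Si 0) (r + s)) (fun T₀ =>
          A.acceptProb (membershipOracles (subspaceTuple (fun i => T₀ ⊔ Si i) (T₀ ⊔ S))))| ≤
      (q : ℝ) * (if s = 1 then Real.sqrt 2 else (s : ℝ)) /
        Real.sqrt ((2 : ℝ) ^ (k - r - l - s)) := by
  have htuple : ∀ T : BitSubspace k, subspaceTuple (fun i => T ⊔ Si i) (T ⊔ S)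
      = fun j => T ⊔ subspaceTuple Si S j := by
    intro T
    funext j
    cases j <;> rfl
  have hU : ∀ j, Si 0 ≤ subspaceTuple Si S j ∧ subspaceTuple Si S j ≤ S := by
    rintro (_ | i)
    · exact ⟨hS₀S, le_rfl⟩
    · by_cases hi : i = 0
      · subst hi; exact ⟨le_rfl, hS₀S⟩
      · exact ⟨(hSi i hi).1, (hSi i hi).2.1⟩
  have hUl : ∀ j, finrank (ZMod 2) (subspaceTuple Si S j) ≤ r + l := fun j =>
    hS ▸ Submodule.finrank_mono (hU j).2
  simp_rw [htuple]
  refine (A.abs_acceptProb_sub_uniformAverage_le (superspaces (Si 0) (r + s))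
    (superspaces_nonempty (Si 0) (by omega) (by omega)) _
    (fun T => membershipOracles fun j => T ⊔ subspaceTuple Si S j)
    (card_membershipOracles_ne_le (Si 0) hS₀ (subspaceTuple Si S) (fun j => (hU j).1) hUl)
    (fun e he₀ he => two_mul_sqrt_mul_one_sub_le (by omega) he₀ he)).trans ?_
  rw [mul_div_assoc]
  gcongr
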